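/- Let $n,d\ge 1$ and let $f=\sum_\alpha f_\alpha x^\alpha\in\mathbb R[x_1,\dots,x_n]$ be a form of degree $2d$ with support $\operatorname{supp}(f)=\{\alpha\in\mathbb N_0^n: f_\alpha\neq 0\}$. Let $\operatorname{New}(f)$ be the convex hull of $\operatorname{supp}(f)$, let $V(f)$ be its set of vertices, let $$\mathcal S(f)=\{\alpha\in\operatorname{supp}(f):\alpha\in(2\mathbb N_0)^n,\ f_\alpha>0\},\qquad \mathcal I(f)=\operatorname{supp}(f)\setminus\mathcal S(f).$$ For $\beta\in\mathcal I(f)$ let $\mathcal D(\beta)=\{\Delta_1,\dots,\Delta_{N(\beta)}\}$ be the set of all simplices $\Delta\subseteq\mathbb R^n$ (convex hulls of finite affinely independent sets, of any dimension) with vertex set $V(\Delta)\subseteq\mathcal S(f)$ and $\beta$ in the relative interior of $\Delta$. For $\alpha \in V(\Delta_k)$ let $\lambda_{\alpha\beta}^{(k)}$ be the barycentric coordinates of $\beta$ with respect to $\Delta_k$, i.e. $\sum_{\alpha\in V(\Delta_k)}\lambda^{(k)}_{\alpha\beta}=1$ and $\sum_{\alpha\in V(\Delta_k)}\lambda^{(k)}_{\alpha\beta}\,\alpha=\beta$,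 and put $\lambda_{\alpha\beta}^{(k)}=0$ for $\alpha\in\mathcal S(f)\setminus V(\Delta_k)$. Let $\mathcal R(f)$ be the set of those $\alpha\in\mathcal S(f)$ that are not a vertex of any $\Delta\in\mathcal D(\beta)$, for any $\beta\in\mathcal I(f)$. A form $g$ of degree $2d$ is a circuit form if $\mathcal S(g)=V(g)$, this set is affinely independent, and either $\mathcal I(g)=\emptyset$ or $\mathcal I(g)=\{\beta\}$ with $\beta$ in the relative interior of $\operatorname{New}(g)$. The form $f$ is SONC if it is a finite sum of circuit forms of degree $2d$ that are nonnegative on $\mathbb R^n$. **Corollary.** If $f$ is SONC and $$\sum_{\beta\in\mathcal I(f)}|f_\beta|=\sum_{\alpha\in\mathcal S(f)\setminus\mathcal R(f)}f_\alpha ,$$ then for every $\alpha\in\mathcal S(f)\setminus\mathcal R(f)$ and every $\beta\in\mathcal I(f)$ one has $N(\beta)\ge 1$ and $$f_\alpha\ \ge\ \min_{k\in\{1,\dots,N(\beta)\}}\lambda_{\alpha\beta}^{(k)}\,|f_\beta| .$$ -/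

import Mathlib

open scoped BigOperators

noncomputable section

namespace SONC

variable {n : ℕ}

/-- An exponent `α ∈ ℕ₀ⁿ`, viewed as a point of `ℝⁿ`. -/
def expVec (α : Fin n →₀ ℕ) : Fin n → ℝ := fun i => (α i : ℝ)

/-- The set `S(f)` of exponents of monomial squares: even exponents in the support
with a positive coefficient. -/
def squares (f : MvPolynomial (Fin n) ℝ) : Finset (Fin n →₀ ℕ) :=
  open Classical in
  f.support.filter (fun α => (∀ i, Even (α i)) ∧ 0 < f.coeff α)

/-- The set `I(f) = supp(f) \ S(f)`. -/
def nonSquares (f : MvPolynomial (Fin n) ℝ) : Finset (Fin n →₀ ℕ) :=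
  open Classical in
  f.support \ squares f

/-- The Newton polytope `New(f)`, the convex hull of the support. -/
def newton (f : MvPolynomial (Fin n) ℝ) : Set (Fin n → ℝ) :=
  convexHull ℝ (expVec '' (f.support : Set (Fin n →₀ ℕ)))

/-- The set `V(f)` of vertices of the Newton polytope. -/
def vertices (f : MvPolynomial (Fin n) ℝ) : Set (Fin n → ℝ) :=
  (newton f).extremePoints ℝ

/-- Nonnegativity (positive semidefiniteness) on `ℝⁿ`. -/
def IsPSD (f : MvPolynomial (Fin n) ℝ) : Prop :=
  ∀ x : Fin n → ℝ, 0 ≤ MvPolynomial.eval x f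

/-- Circuit polynomials: `S(f) = V(f)` is affinely independent, and `I(f)` is either empty or
consists of one exponent in the relative interior of the Newton polytope. -/
structure IsCircuit (f : MvPolynomial (Fin n) ℝ) : Prop where
  squares_eq : expVec '' (squares f : Set (Fin n →₀ ℕ)) = vertices f
  affineIndependent : AffineIndependent ℝ ((↑) : vertices f → (Fin n → ℝ))
  inner : (∃ β, nonSquares f = {β} ∧ expVec β ∈ intrinsicInterior ℝ (newton f)) ∨
    nonSquares f = ∅

/-- The set `C_{n,2d}` of sums of nonnegative circuit forms of degree `2d` in `n` variables. -/
def IsSONC (d : ℕ) (f : MvPolynomial (Fin n) ℝ) : Prop :=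
  ∃ (s : ℕ) (g : Fin s → MvPolynomial (Fin n) ℝ), 0 < s ∧
    (∀ i, (g i).IsHomogeneous (2 * d) ∧ IsCircuit (g i) ∧ IsPSD (g i)) ∧ f = ∑ i, g i

/-- The set `D(β)` of all simplices (of any dimension) with vertices in `S(f)` that have `β` in
their relative interior. A simplex is represented by its finite set of vertices. -/
def simplices (f : MvPolynomial (Fin n) ℝ) (β : Fin n →₀ ℕ) : Finset (Finset (Fin n →₀ ℕ)) :=
  open Classical in
  (squares f).powerset.filter (fun V =>
    AffineIndependent ℝ (fun α : V => expVec (α : Fin n →₀ ℕ)) ∧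
    expVec β ∈ intrinsicInterior ℝ (convexHull ℝ (expVec '' (V : Set (Fin n →₀ ℕ)))))

/-- The set `R(f)` of those exponents in `S(f)` that are not a vertex of any simplex in `D(β)`,
for any `β ∈ I(f)`. -/
def unusedSquares (f : MvPolynomial (Fin n) ℝ) : Finset (Fin n →₀ ℕ) :=
  open Classical in
  (squares f).filter (fun α => ∀ β ∈ nonSquares f, ∀ V ∈ simplices f β, α ∉ V)

/-- `w` is a vector of barycentric coordinates of `β` with respect to the points of `V`,
extended by zero outside `V`. -/
def IsBarycentric (V : Finset (Fin n →₀ ℕ)) (β : Fin n →₀ ℕ) (w : (Fin n →₀ ℕ) → ℝ) : Prop :=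
  (∀ α, α ∉ V → w α = 0) ∧ ∑ α ∈ V, w α = 1 ∧ ∑ α ∈ V, w α • expVec α = expVec β

/-- The barycentric coordinate of `β` at `α` with respect to the simplex with vertex set `V`;
it is zero if `α` is not in `V`. (Existence and uniqueness on `simplices f β` are
`existsUnique_isBarycentric`.) -/
def baryCoord (V : Finset (Fin n →₀ ℕ)) (β α : Fin n →₀ ℕ) : ℝ :=
  open Classical in
  if h : ∃ w, IsBarycentric V β w then h.choose α else 0

theorem expVec_injective : Function.Injective (expVec : (Fin n →₀ ℕ) → (Fin n → ℝ)) := by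
  intro a b h
  ext i
  have := congrFun h i
  simpa [expVec] using this

theorem existsUnique_isBarycentric {f : MvPolynomial (Fin n) ℝ} {β : Fin n →₀ ℕ}
    {V : Finset (Fin n →₀ ℕ)} (hV : V ∈ simplices f β) : ∃! w, IsBarycentric V β w := by
  classical
  simp only [simplices, Finset.mem_filter] at hV
  obtain ⟨-, hind, hβ⟩ := hV
  have hβ' := intrinsicInterior_subset hβ
  have hex : ∃ w, IsBarycentric V β w := by
    rw [← Finset.coe_image, Finset.mem_convexHull'] at hβ'
    obtain ⟨w, -, hw1, hw2⟩ := hβ'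
    rw [Finset.sum_image (fun a _ b _ h => expVec_injective h)] at hw1 hw2
    refine ⟨fun α => if α ∈ V then w (expVec α) else 0, ?_, ?_, ?_⟩
    · intro α hα
      simp [hα]
    · rw [← hw1]
      exact Finset.sum_congr rfl (fun α hα => by simp [hα])
    · rw [← hw2]
      exact Finset.sum_congr rfl (fun α hα => by simp [hα])
  obtain ⟨w, hw⟩ := hex
  refine ⟨w, hw, ?_⟩
  intro v hv
  funext α
  by_cases hα : α ∈ V
  · rw [affineIndependent_iff] at hind
    have key := hind Finset.univ (fun a => v a - w a) (by
      rw [Finset.sum_coe_sort V (fun a => v a - w a), Finset.sum_sub_distrib, hv.2.1, hw.2.1,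
        sub_self]) (by
      rw [Finset.sum_coe_sort V (fun a => (v a - w a) • expVec a)]
      simp only [sub_smul]
      rw [Finset.sum_sub_distrib, hv.2.2, hw.2.2, sub_self]) ⟨α, hα⟩ (Finset.mem_univ _)
    exact sub_eq_zero.mp key
  · rw [hv.1 α hα, hw.1 α hα]

theorem isBarycentric_baryCoord {f : MvPolynomial (Fin n) ℝ} {β : Fin n →₀ ℕ}
    {V : Finset (Fin n →₀ ℕ)} (hV : V ∈ simplices f β) :
    IsBarycentric V β (baryCoord V β) := by
  have h := (existsUnique_isBarycentric hV).exists
  have e : baryCoord V β = h.choose := by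
    funext α
    simp only [baryCoord, dif_pos h]
  rw [e]
  exact h.choose_spec

end SONC

end

/-! Substituting `x = exp t` after suitable sign changes turns each nonnegative circuit form into a
nonnegative signomial with at most one negative term. Grouping these by inner exponent and removing
all cancellation (`exists_cancellationFree`) gives numbers `c β α ≥ 0` with `|f_β| e^{β·t} ≤ ∑ α, c
β α * e^{α·t}` for all `t`, and `∑ β, c β α ≤ f_α` (`IsSONC.exists_decomposition`).

In the inequality for `β`, only exponents on the face of `β` matter (`le_sum_faceSquares`), and each
of these is a vertex of a simplex in `D(β)`, hence outside `R(f)`. At `t = 0` this reads `|f_β| ≤ ∑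
c β α` over the face. Summed over `β`, the right side is at most the sum of `f_α` over `S(f) \
R(f)`, which by hypothesis is `∑ |f_β|`. So every inequality is tight at the origin.

Tightness makes the origin a minimum. The first-order condition (`sum_smul_expVec_of_tight`) says
that the weights `c β α / |f_β|` represent `β` as a convex combination of squares. A Carathéodory
reduction that does not increase the weight at a chosen `α` yields a simplex with `λ_α |f_β| ≤ c β α
≤ f_α`. -/

noncomputable section

namespace SONC

variable {n : ℕ}

/-! ### Convex geometry: Farkas, Carathéodory with a cost, relative interiors. -/

/-- **Farkas' lemma** for finitely many linear functionals on an arbitrary real vector space. -/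
theorem farkas {ι W : Type*} [AddCommGroup W] [Module ℝ W] (s : Finset ι)
    (a : ι → W →ₗ[ℝ] ℝ) (b : W →ₗ[ℝ] ℝ)
    (h : ∀ x, (∀ i ∈ s, a i x ≤ 0) → b x ≤ 0) :
    ∃ u : ι → ℝ, (∀ i ∈ s, 0 ≤ u i) ∧ b = ∑ i ∈ s, u i • a i := by
  classical
  induction s using Finset.induction_on generalizing a b with
  | empty =>
    refine ⟨0, by simp, ?_⟩
    ext x
    have h1 := h x (by simp)
    have h2 := h (-x) (by simp)
    simp only [map_neg] at h2
    simp only [Finset.sum_empty, LinearMap.zero_apply]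
    linarith
  | insert j s hj ih =>
    by_cases hs : ∀ x, (∀ i ∈ s, a i x ≤ 0) → b x ≤ 0
    · obtain ⟨u, hu, hb⟩ := ih a b hs
      refine ⟨Function.update u j 0, ?_, ?_⟩
      · intro i hi
        by_cases hij : i = j
        · simp [hij]
        · simpa [hij] using hu i (Finset.mem_of_mem_insert_of_ne hi hij)
      · rw [Finset.sum_insert hj, hb]
        simp only [Function.update_self, zero_smul, zero_add]
        refine Finset.sum_congr rfl fun i hi => ?_
        rw [Function.update_of_ne (ne_of_mem_of_not_mem hi hj)]
    · push Not at hs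
      obtain ⟨x₀, hx₀, hbx₀⟩ := hs
      have hj0 : 0 < a j x₀ := by
        by_contra hneg
        refine absurd (h x₀ fun i hi => ?_) (not_le.mpr hbx₀)
        rcases Finset.mem_insert.mp hi with rfl | hi
        · exact not_lt.mp hneg
        · exact hx₀ i hi
      obtain ⟨y, hy, hby, hjy⟩ : ∃ y, (∀ i ∈ s, a i y ≤ 0) ∧ 0 < b y ∧ a j y = 1 := by
        refine ⟨(a j x₀)⁻¹ • x₀, fun i hi => ?_, ?_, ?_⟩
        · rw [map_smul, smul_eq_mul]
          exact mul_nonpos_of_nonneg_of_nonpos (by positivity) (hx₀ i hi)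
        · rw [map_smul, smul_eq_mul]; positivity
        · rw [map_smul, smul_eq_mul]; exact inv_mul_cancel₀ hj0.ne'
      -- These functionals are `a i` and `b` composed with the projection `x ↦ x - a j x • y` onto
      -- the kernel of `a j`.
      obtain ⟨u, hu, hb⟩ := ih (fun i => a i - a i y • a j) (b - b y • a j) (by
        intro x hx
        have := h (x - a j x • y) (by
          intro i hi
          rcases Finset.mem_insert.mp hi with rfl | hi
          · simp [hjy]
          · have := hx i hi
            simp only [LinearMap.sub_apply, LinearMap.smul_apply, smul_eq_mul] at this
            simp only [map_sub, map_smul, smul_eq_mul]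
            linarith)
        simp only [map_sub, map_smul, smul_eq_mul] at this
        simp only [LinearMap.sub_apply, LinearMap.smul_apply, smul_eq_mul]
        linarith)
      refine ⟨Function.update u j (b y - ∑ i ∈ s, u i * a i y), ?_, ?_⟩
      · intro i hi
        by_cases hij : i = j
        · subst hij
          rw [Function.update_self, sub_nonneg]
          exact (Finset.sum_nonpos fun i hi =>
            mul_nonpos_of_nonneg_of_nonpos (hu i hi) (hy i hi)).trans hby.le
        · simpa [hij] using hu i (Finset.mem_of_mem_insert_of_ne hi hij)
      · have hsum : ∑ i ∈ s, Function.update u j (b y - ∑ i ∈ s, u i * a i y) i • a i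
            = ∑ i ∈ s, u i • a i :=
          Finset.sum_congr rfl fun i hi => by
            rw [Function.update_of_ne (ne_of_mem_of_not_mem hi hj)]
        rw [Finset.sum_insert hj, hsum, Function.update_self]
        ext x
        have hbx := LinearMap.congr_fun hb x
        simp only [LinearMap.sub_apply, LinearMap.add_apply, LinearMap.smul_apply,
          LinearMap.sum_apply, smul_eq_mul, mul_sub, Finset.sum_sub_distrib, ← mul_assoc,
          ← Finset.sum_mul] at hbx ⊢
        linarith

/-- A convex combination can be replaced by one with affinely independent support and positive
weights, without increasing a given linear functional of the weights. -/
theorem exists_affineIndependent_combination {ι E : Type*} [AddCommGroup E] [Module ℝ E]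
    (e : ι → E) (l : ι → ℝ) (b : E) (S : Finset ι) (p : ι → ℝ) (hp : ∀ i ∈ S, 0 ≤ p i)
    (hp1 : ∑ i ∈ S, p i = 1) (hpb : ∑ i ∈ S, p i • e i = b) :
    ∃ V ⊆ S, ∃ w : ι → ℝ, AffineIndependent ℝ (fun i : V => e i) ∧ (∀ i ∈ V, 0 < w i) ∧
      ∑ i ∈ V, w i = 1 ∧ ∑ i ∈ V, w i • e i = b ∧
      ∑ i ∈ V, w i * l i ≤ ∑ i ∈ S, p i * l i := by
  classical
  induction S using Finset.strongInduction generalizing p with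
  | H S ih =>
    have reduce : ∀ q : ι → ℝ, (∀ i ∈ S, 0 ≤ q i) → ∑ i ∈ S, q i = 1 →
        ∑ i ∈ S, q i • e i = b → ∑ i ∈ S, q i * l i ≤ ∑ i ∈ S, p i * l i →
        (∃ i ∈ S, q i = 0) → ∃ V ⊆ S, ∃ w : ι → ℝ, AffineIndependent ℝ (fun i : V => e i) ∧
          (∀ i ∈ V, 0 < w i) ∧ ∑ i ∈ V, w i = 1 ∧ ∑ i ∈ V, w i • e i = b ∧
          ∑ i ∈ V, w i * l i ≤ ∑ i ∈ S, p i * l i := by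
      rintro q hq hq1 hqb hql ⟨i, hi, hqi⟩
      obtain ⟨V, hV, w, h1, h2, h3, h4, h5⟩ := ih (S.erase i) (Finset.erase_ssubset hi) q
        (fun j hj => hq j (Finset.mem_of_mem_erase hj))
        (by rw [Finset.sum_erase _ hqi, hq1])
        (by rw [Finset.sum_erase _ (by simp [hqi]), hqb])
      refine ⟨V, hV.trans (Finset.erase_subset _ _), w, h1, h2, h3, h4, h5.trans ?_⟩
      rwa [Finset.sum_erase _ (by simp [hqi])]
    by_cases hz : ∃ i ∈ S, p i = 0
    · exact reduce p hp hp1 hpb le_rfl hz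
    push Not at hz
    have hpos : ∀ i ∈ S, 0 < p i := fun i hi => lt_of_le_of_ne (hp i hi) (hz i hi).symm
    by_cases hind : AffineIndependent ℝ (fun i : S => e i)
    · exact ⟨S, subset_rfl, p, hind, hpos, hp1, hpb, le_rfl⟩
    -- An affine dependence, with its sign chosen so that moving along it does not raise the cost.
    obtain ⟨q, hq0, hqe, hql, hqn⟩ : ∃ q : ι → ℝ, ∑ i ∈ S, q i = 0 ∧ ∑ i ∈ S, q i • e i = 0 ∧
        ∑ i ∈ S, q i * l i ≤ 0 ∧ ∃ i ∈ S, q i ≠ 0 := by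
      have : ∃ q : ι → ℝ, ∑ i ∈ S, q i = 0 ∧ ∑ i ∈ S, q i • e i = 0 ∧ ∃ i ∈ S, q i ≠ 0 := by
        rw [affineIndependent_iff_of_fintype] at hind
        push Not at hind
        obtain ⟨q, hq0, hqe, i, hi⟩ := hind
        rw [Finset.univ.weightedVSub_eq_linear_combination hq0] at hqe
        have hext : ∀ i : S, (fun j => if h : j ∈ S then q ⟨j, h⟩ else (0 : ℝ)) (i : ι) = q i := by
          intro i; simp
        refine ⟨fun j => if h : j ∈ S then q ⟨j, h⟩ else (0 : ℝ), ?_, ?_, i, i.2, ?_⟩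
        · refine (Finset.sum_coe_sort S _).symm.trans (Eq.trans ?_ hq0)
          exact Finset.sum_congr rfl fun i _ => hext i
        · rw [← Finset.sum_coe_sort S (fun j => (if h : j ∈ S then q ⟨j, h⟩ else 0) • e j), ← hqe]
          exact Finset.sum_congr rfl fun i _ => by rw [← hext i]
        · rw [hext i]; exact hi
      obtain ⟨q, hq0, hqe, i, hi, hqi⟩ := this
      rcases le_total (∑ i ∈ S, q i * l i) 0 with h | h
      · exact ⟨q, hq0, hqe, h, i, hi, hqi⟩
      · refine ⟨fun i => - q i, ?_, ?_, ?_, i, hi, neg_ne_zero.mpr hqi⟩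
        · rw [Finset.sum_neg_distrib, hq0, neg_zero]
        · simp only [neg_smul]; rw [Finset.sum_neg_distrib, hqe, neg_zero]
        · simp only [neg_mul]; rw [Finset.sum_neg_distrib]; linarith
    have hneg : (S.filter fun i => q i < 0).Nonempty := by
      by_contra hne
      rw [Finset.not_nonempty_iff_eq_empty, Finset.filter_eq_empty_iff] at hne
      obtain ⟨i, hi, hqi⟩ := hqn
      exact hqi ((Finset.sum_eq_zero_iff_of_nonneg fun j hj => not_lt.mp (hne hj)).mp hq0 i hi)
    -- The ratio test: the largest step along `q` that keeps all weights nonnegative makes the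
    -- weight at `k` vanish.
    obtain ⟨k, hk, hmin⟩ := Finset.exists_min_image _ (fun i => p i / - q i) hneg
    rw [Finset.mem_filter] at hk
    set t := p k / - q k with ht
    have ht0 : 0 < t := div_pos (hpos k hk.1) (by linarith [hk.2])
    refine reduce (fun i => p i + t * q i) ?_ ?_ ?_ ?_ ⟨k, hk.1, ?_⟩
    · intro i hi
      rcases lt_or_ge (q i) 0 with hqi | hqi
      · have := hmin i (Finset.mem_filter.mpr ⟨hi, hqi⟩)
        rw [le_div_iff₀ (by linarith)] at this
        change 0 ≤ p i + t * q i
        linarith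
      · exact add_nonneg (hp i hi) (mul_nonneg ht0.le hqi)
    · rw [Finset.sum_add_distrib, ← Finset.mul_sum, hq0, hp1]; simp
    · simp only [add_smul, mul_smul]
      rw [Finset.sum_add_distrib, ← Finset.smul_sum, hqe, hpb]; simp
    · simp only [add_mul, mul_assoc]
      rw [Finset.sum_add_distrib, ← Finset.mul_sum]
      nlinarith
    · have : q k ≠ 0 := hk.2.ne
      simp only [ht]; field_simp; ring

/-- A convex combination with positive weights lies in the relative interior of the convex hull. -/
theorem combination_mem_intrinsicInterior {ι E : Type*} [NormedAddCommGroup E] [NormedSpace ℝ E]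
    [FiniteDimensional ℝ E] (e : ι → E) (V : Finset ι) (w : ι → ℝ) (hw : ∀ i ∈ V, 0 < w i)
    (hw1 : ∑ i ∈ V, w i = 1) :
    ∑ i ∈ V, w i • e i ∈ intrinsicInterior ℝ (convexHull ℝ (e '' (V : Set ι))) := by
  classical
  set C := convexHull ℝ (e '' (V : Set ι)) with hC
  have hconv : Convex ℝ C := convex_convexHull _ _
  have comb : ∀ v : ι → ℝ, (∀ i ∈ V, 0 ≤ v i) → ∑ i ∈ V, v i = 1 → ∑ i ∈ V, v i • e i ∈ C :=
    fun v hv hv1 => hconv.sum_mem hv hv1 fun i hi => subset_convexHull _ _ ⟨i, hi, rfl⟩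
  have hVne : V.Nonempty := by
    by_contra hne
    rw [Finset.not_nonempty_iff_eq_empty] at hne
    simp [hne] at hw1
  obtain ⟨y, hy⟩ := Set.Nonempty.intrinsicInterior hconv
    ⟨_, comb w (fun i hi => (hw i hi).le) hw1⟩
  have hyC := intrinsicInterior_subset hy
  obtain ⟨v, hv, hv1, hvy⟩ : ∃ v : ι → ℝ, (∀ i ∈ V, 0 ≤ v i) ∧ ∑ i ∈ V, v i = 1 ∧
      ∑ i ∈ V, v i • e i = y := by
    have hsub : C ⊆ {y | ∃ v : ι → ℝ, (∀ i ∈ V, 0 ≤ v i) ∧ ∑ i ∈ V, v i = 1 ∧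
        ∑ i ∈ V, v i • e i = y} := by
      refine convexHull_min ?_ ?_
      · rintro _ ⟨i, hi, rfl⟩
        refine ⟨Pi.single i 1, fun j _ => ?_, ?_, ?_⟩
        · by_cases h : j = i
          · subst h; simp
          · simp [h]
        · rw [Finset.sum_eq_single i (fun j _ h => by simp [h]) (fun h => absurd hi h)]
          simp
        · rw [Finset.sum_eq_single i (fun j _ h => by simp [h]) (fun h => absurd hi h)]
          simp
      · rintro _ ⟨v, hv, hv1, rfl⟩ _ ⟨v', hv', hv1', rfl⟩ a b ha hb hab
        refine ⟨fun i => a * v i + b * v' i, fun i hi => ?_, ?_, ?_⟩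
        · exact add_nonneg (mul_nonneg ha (hv i hi)) (mul_nonneg hb (hv' i hi))
        · rw [Finset.sum_add_distrib, ← Finset.mul_sum, ← Finset.mul_sum, hv1, hv1']; linarith
        · simp only [add_smul, mul_smul]
          rw [Finset.sum_add_distrib, ← Finset.smul_sum, ← Finset.smul_sum]
    exact hsub hyC
  obtain ⟨k, hk, hmin⟩ := Finset.exists_min_image V w hVne
  have hwle : ∀ i ∈ V, w i ≤ 1 := fun i hi =>
    hw1 ▸ Finset.single_le_sum (fun j hj => (hw j hj).le) hi
  have hvle : ∀ i ∈ V, v i ≤ 1 := fun i hi => hv1 ▸ Finset.single_le_sum hv hi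
  -- Since `v i ≤ 1` and `w k ≤ w i`, this choice keeps `w - ε v` nonnegative. The given point is
  -- then the image of the relative interior point `y` under the homothety with ratio `ε` and centre
  -- `z ∈ C`.
  set ε := w k / 2 with hε
  have hε0 : 0 < ε := half_pos (hw k hk)
  have hε1 : 0 < 1 - ε := by linarith [hwle k hk]
  set z := ∑ i ∈ V, ((1 - ε)⁻¹ * (w i - ε * v i)) • e i with hz
  have hzC : z ∈ C := by
    refine comb _ (fun i hi => mul_nonneg (by positivity) ?_) ?_
    · nlinarith [hmin i hi, hvle i hi, hv i hi, hw k hk]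
    · rw [← Finset.mul_sum, Finset.sum_sub_distrib, ← Finset.mul_sum, hw1, hv1, mul_one]
      exact inv_mul_cancel₀ hε1.ne'
  have hcomb : ∑ i ∈ V, w i • e i = ε • (y - z) + z := by
    have h1 : (1 - ε) • z = ∑ i ∈ V, w i • e i - ε • y := by
      rw [hz, ← hvy, Finset.smul_sum, Finset.smul_sum, ← Finset.sum_sub_distrib]
      refine Finset.sum_congr rfl fun i _ => ?_
      rw [smul_smul, smul_smul, ← sub_smul, ← mul_assoc, mul_inv_cancel₀ hε1.ne', one_mul]
    rw [sub_smul, one_smul] at h1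
    rw [eq_add_of_sub_eq h1.symm, smul_sub]
    abel
  obtain ⟨y', hy', rfl⟩ := hy
  let z' : affineSpan ℝ C := ⟨z, subset_affineSpan ℝ C hzC⟩
  have : Nonempty (affineSpan ℝ C) := ⟨z'⟩
  refine ⟨AffineMap.homothety z' ε y', ?_, ?_⟩
  · have hopen := AffineMap.homothety_isOpenMap z' ε hε0.ne'
      (interior ((↑) ⁻¹' C : Set (affineSpan ℝ C))) isOpen_interior
    refine interior_maximal ?_ hopen ⟨y', hy', rfl⟩
    rintro _ ⟨x, hx, rfl⟩
    have hx := interior_subset hx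
    change ε • ((x : E) - z) + z ∈ C
    have := hconv hx hzC hε0.le hε1.le (by ring)
    convert this using 1
    rw [smul_sub, sub_smul, one_smul]; abel
  · rw [hcomb]; rfl

/-! ### Removing cancellation between summands. -/

/-- Given members of a convex cone, one for each coordinate `k`, with nonnegative coordinates
outside `k`, the sum can be redistributed such that coordinates that remain negative are not
cancelled by any other summand. -/
theorem exists_cancellationFree {ι : Type*} (A : Finset ι) (P : (ι → ℝ) → Prop)
    (hadd : ∀ c c', P c → P c' → P (c + c')) (hsmul : ∀ (t : ℝ) c, 0 ≤ t → P c → P (t • c))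
    (f : ι → ι → ℝ) (hP : ∀ k ∈ A, P (f k))
    (hf : ∀ k ∈ A, ∀ j ∈ A, j ≠ k → 0 ≤ f k j) :
    ∃ g : ι → ι → ℝ, (∀ k ∈ A, P (g k)) ∧ (∀ k ∈ A, ∀ j ∈ A, j ≠ k → 0 ≤ g k j) ∧
      ∑ k ∈ A, g k = ∑ k ∈ A, f k ∧
      ∀ j ∈ A, 0 ≤ g j j ∨ ∀ k ∈ A, k ≠ j → g k j = 0 := by
  classical
  suffices H : ∀ B ⊆ A, ∃ g : ι → ι → ℝ, (∀ k ∈ A, P (g k)) ∧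
      (∀ k ∈ A, ∀ j ∈ A, j ≠ k → 0 ≤ g k j) ∧ ∑ k ∈ A, g k = ∑ k ∈ A, f k ∧
      ∀ j ∈ B, 0 ≤ g j j ∨ ∀ k ∈ A, k ≠ j → g k j = 0 from H A subset_rfl
  intro B
  induction B using Finset.induction_on with
  | empty => exact fun _ => ⟨f, hP, hf, rfl, by simp⟩
  | insert c B hc ih =>
    intro hB
    have hcA : c ∈ A := hB (Finset.mem_insert_self _ _)
    have hBA : B ⊆ A := (Finset.subset_insert _ _).trans hB
    obtain ⟨g, gP, g0, gsum, gB⟩ := ih hBA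
    rcases le_or_gt 0 (g c c) with hcc | hcc
    · refine ⟨g, gP, g0, gsum, fun j hj => ?_⟩
      rcases Finset.mem_insert.mp hj with rfl | hj
      · exact Or.inl hcc
      · exact gB j hj
    set Q := ∑ k ∈ A.erase c, g k c with hQ
    have hp : ∀ k ∈ A, k ≠ c → 0 ≤ g k c := fun k hk hkc => g0 k hk c hcA hkc.symm
    have hQ0 : 0 ≤ Q := Finset.sum_nonneg fun k hk =>
      hp k (Finset.mem_of_mem_erase hk) (Finset.ne_of_mem_erase hk)
    -- Each `g k` receives the share `g k c / D` of `g c`. If `D = -g c c`, the coordinate `c` of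
    -- every other summand becomes zero; if `D = Q`, all of `g c` is given away.
    set D := max Q (- g c c) with hD
    have hDQ : Q ≤ D := le_max_left _ _
    have hDm : - g c c ≤ D := le_max_right _ _
    have hD0 : 0 < D := by linarith
    let g' : ι → ι → ℝ := fun k => if k = c then (1 - Q / D) • g c else g k + (g k c / D) • g c
    have g'c : g' c = (1 - Q / D) • g c := if_pos rfl
    have g'k : ∀ k, k ≠ c → g' k = g k + (g k c / D) • g c := fun k hk => if_neg hk
    have hQD : 0 ≤ 1 - Q / D := by rw [sub_nonneg, div_le_one hD0]; exact hDQ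
    have g'kj : ∀ k, k ≠ c → ∀ j, g' k j = g k j + g k c / D * g c j := fun k hk j => by
      rw [g'k k hk]; rfl
    refine ⟨g', ?_, ?_, ?_, ?_⟩
    · intro k hk
      by_cases hkc : k = c
      · subst hkc; rw [g'c]; exact hsmul _ _ hQD (gP _ hk)
      · rw [g'k k hkc]
        exact hadd _ _ (gP k hk) (hsmul _ _ (div_nonneg (hp k hk hkc) hD0.le) (gP c hcA))
    · intro k hk j hj hjk
      by_cases hkc : k = c
      · subst hkc; rw [g'c]; exact mul_nonneg hQD (g0 k hk j hj hjk)
      · rw [g'kj k hkc]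
        by_cases hjc : j = c
        · subst hjc
          have : g k j + g k j / D * g j j = g k j * ((D + g j j) / D) := by field_simp
          rw [this]
          exact mul_nonneg (hp k hk hkc) (div_nonneg (by linarith) hD0.le)
        · exact add_nonneg (g0 k hk j hj hjk)
            (mul_nonneg (div_nonneg (hp k hk hkc) hD0.le) (g0 c hcA j hj hjc))
    · rw [← gsum, ← Finset.add_sum_erase A g' hcA, ← Finset.add_sum_erase A g hcA, g'c,
        Finset.sum_congr rfl fun k hk => g'k k (Finset.ne_of_mem_erase hk),
        Finset.sum_add_distrib, ← Finset.sum_smul, ← Finset.sum_div, sub_smul, one_smul]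
      abel
    · intro j hj
      rcases Finset.mem_insert.mp hj with rfl | hjB
      · rcases le_total Q (- g j j) with h | h
        · right
          intro k hk hkj
          have : D = - g j j := max_eq_right h
          rw [g'kj k hkj, this]
          have : g j j ≠ 0 := hcc.ne
          field_simp; ring
        · left
          have : D = Q := max_eq_left h
          rw [g'c, ← this, div_self hD0.ne', sub_self, zero_smul]; rfl
      -- Indices treated earlier keep their property: `g c j ≥ 0` preserves a nonnegative diagonal
      -- entry, and `g c j = 0` preserves a column vanishing off the diagonal.
      · have hjA := hBA hjB
        have hjc : j ≠ c := fun h => hc (h ▸ hjB)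
        rcases gB j hjB with h | h
        · left
          rw [g'kj j hjc]
          exact add_nonneg h (mul_nonneg (div_nonneg (hp j hjA hjc) hD0.le) (g0 c hcA j hjA hjc))
        · right
          intro k hk hkj
          by_cases hkc : k = c
          · subst hkc; rw [g'c, Pi.smul_apply, h k hk hkj, smul_zero]
          · rw [g'kj k hkc, h k hk hkj, h c hcA hjc.symm, mul_zero, add_zero]

/-! ### Signomial representatives and the decomposition of SONC forms. -/

/-- The monomial `x ^ α` at the point `x = exp t`. -/
def expMonomial (α : Fin n →₀ ℕ) (t : Fin n → ℝ) : ℝ := Real.exp (expVec α ⬝ᵥ t)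

theorem expMonomial_pos (α : Fin n →₀ ℕ) (t : Fin n → ℝ) : 0 < expMonomial α t := Real.exp_pos _

theorem expMonomial_zero (α : Fin n →₀ ℕ) : expMonomial α 0 = 1 := by simp [expMonomial]

theorem expMonomial_eq_prod (α : Fin n →₀ ℕ) (t : Fin n → ℝ) :
    expMonomial α t = ∏ i, Real.exp (t i) ^ α i := by
  simp only [expMonomial, dotProduct, expVec, Real.exp_sum, Real.exp_nat_mul]

/-- The coefficients of the signomial representative of `f`: every term that is not an even
power with positive coefficient is replaced by its negative absolute value. -/
def sigCoeff (f : MvPolynomial (Fin n) ℝ) (γ : Fin n →₀ ℕ) : ℝ :=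
  open Classical in
  if ∀ i, Even (γ i) then f.coeff γ else - |f.coeff γ|

theorem mem_squares {f : MvPolynomial (Fin n) ℝ} {γ : Fin n →₀ ℕ} :
    γ ∈ squares f ↔ (∀ i, Even (γ i)) ∧ 0 < f.coeff γ := by
  simp only [squares, Finset.mem_filter, MvPolynomial.mem_support_iff]
  exact ⟨fun h => h.2, fun h => ⟨h.2.ne', h⟩⟩

theorem sigCoeff_of_mem_squares {f : MvPolynomial (Fin n) ℝ} {γ : Fin n →₀ ℕ}
    (h : γ ∈ squares f) : sigCoeff f γ = f.coeff γ :=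
  if_pos (mem_squares.mp h).1

theorem sigCoeff_of_notMem_squares {f : MvPolynomial (Fin n) ℝ} {γ : Fin n →₀ ℕ}
    (h : γ ∉ squares f) : sigCoeff f γ = - |f.coeff γ| := by
  unfold sigCoeff
  split_ifs with he
  · rw [abs_of_nonpos (not_lt.mp fun hpos => h (mem_squares.mpr ⟨he, hpos⟩)), neg_neg]
  · rfl

theorem mem_nonSquares {f : MvPolynomial (Fin n) ℝ} {γ : Fin n →₀ ℕ} :
    γ ∈ nonSquares f ↔ f.coeff γ ≠ 0 ∧ γ ∉ squares f := by
  simp only [nonSquares, Finset.mem_sdiff, MvPolynomial.mem_support_iff]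

theorem sigCoeff_nonneg {f : MvPolynomial (Fin n) ℝ} {γ : Fin n →₀ ℕ}
    (h : γ ∉ nonSquares f) : 0 ≤ sigCoeff f γ := by
  by_cases hs : γ ∈ squares f
  · rw [sigCoeff_of_mem_squares hs]; exact (mem_squares.mp hs).2.le
  · have : f.coeff γ = 0 := by
      by_contra h0; exact h (mem_nonSquares.mpr ⟨h0, hs⟩)
    rw [sigCoeff_of_notMem_squares hs, this, abs_zero, neg_zero]

/-- Equality at even exponents, the triangle inequality elsewhere. The gap is the nonnegative
remainder in the decomposition. -/
theorem sum_sigCoeff_le {s : ℕ} (g : Fin s → MvPolynomial (Fin n) ℝ) (γ : Fin n →₀ ℕ) :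
    ∑ i, sigCoeff (g i) γ ≤ sigCoeff (∑ i, g i) γ := by
  unfold sigCoeff
  rw [MvPolynomial.coeff_sum]
  split_ifs with h
  · exact le_rfl
  · rw [Finset.sum_neg_distrib, neg_le_neg_iff]
    exact Finset.abs_sum_le_sum_abs _ _

/-- The signomial representative of a nonnegative polynomial with at most one inner term is
nonnegative. -/
theorem IsPSD.sum_sigCoeff_nonneg {g : MvPolynomial (Fin n) ℝ} (hg : IsPSD g)
    {β : Fin n →₀ ℕ} (hβ : nonSquares g ⊆ {β}) {A : Finset (Fin n →₀ ℕ)} (hA : g.support ⊆ A)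
    (t : Fin n → ℝ) : 0 ≤ ∑ γ ∈ A, sigCoeff g γ * expMonomial γ t := by
  classical
  -- A choice of orthant: flipping one variable of odd degree makes a positive inner term negative,
  -- while monomial squares are unaffected.
  have key : ∃ ε : Fin n → ℝ, (∀ i, ε i = 1 ∨ ε i = -1) ∧
      g.coeff β * ∏ i, ε i ^ β i ≤ sigCoeff g β := by
    by_cases h : (∀ i, Even (β i)) ∨ g.coeff β ≤ 0
    · refine ⟨1, fun _ => Or.inl rfl, ?_⟩
      simp only [Pi.one_apply, one_pow, Finset.prod_const_one, mul_one]
      unfold sigCoeff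
      split_ifs with he
      · exact le_rfl
      · rw [abs_of_nonpos (h.resolve_left he), neg_neg]
    · push Not at h
      obtain ⟨⟨i, hi⟩, hpos⟩ := h
      refine ⟨Function.update 1 i (-1), fun j => ?_, ?_⟩
      · by_cases hj : j = i
        · subst hj; simp
        · simp [hj]
      · rw [Finset.prod_eq_single i (fun j _ hj => by simp [hj]) (by simp), Function.update_self,
          (Nat.not_even_iff_odd.mp hi).neg_one_pow]
        unfold sigCoeff
        rw [if_neg (fun he => hi (he i)), abs_of_pos hpos]
        linarith
  obtain ⟨ε, hε, hεβ⟩ := key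
  have hle : ∀ γ ∈ A, g.coeff γ * ∏ i, ε i ^ γ i ≤ sigCoeff g γ := by
    intro γ _
    by_cases hγβ : γ = β
    · rw [hγβ]; exact hεβ
    by_cases hs : γ ∈ squares g
    · rw [sigCoeff_of_mem_squares hs, Finset.prod_eq_one, mul_one]
      intro i _
      rcases hε i with h | h
      · rw [h, one_pow]
      · rw [h, ((mem_squares.mp hs).1 i).neg_one_pow]
    · have h0 : g.coeff γ = 0 := by
        by_contra h0
        exact hγβ (Finset.mem_singleton.mp (hβ (mem_nonSquares.mpr ⟨h0, hs⟩)))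
      rw [sigCoeff_of_notMem_squares hs, h0]; simp
  refine (hg fun i => ε i * Real.exp (t i)).trans ?_
  rw [MvPolynomial.eval_eq', Finset.sum_subset hA fun γ _ h => by
    rw [MvPolynomial.notMem_support_iff.mp h, zero_mul]]
  refine Finset.sum_le_sum fun γ hγ => ?_
  simp only [mul_pow]
  rw [Finset.prod_mul_distrib, ← mul_assoc, ← expMonomial_eq_prod]
  exact mul_le_mul_of_nonneg_right (hle γ hγ) (expMonomial_pos _ _).le

/-- A SONC form has a decomposition into signomials with one negative term each that involves
no cancellation. -/
theorem IsSONC.exists_decomposition {d : ℕ} {f : MvPolynomial (Fin n) ℝ} (hf : IsSONC d f) :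
    ∃ c : (Fin n →₀ ℕ) → (Fin n →₀ ℕ) → ℝ,
      (∀ β ∈ nonSquares f, ∀ α ∈ squares f, 0 ≤ c β α) ∧
      (∀ β ∈ nonSquares f, ∀ t, |f.coeff β| * expMonomial β t ≤
        ∑ α ∈ squares f, c β α * expMonomial α t) ∧
      ∀ α ∈ squares f, ∑ β ∈ nonSquares f, c β α ≤ f.coeff α := by
  classical
  obtain ⟨s, g, -, hg, rfl⟩ := hf
  set f := ∑ i, g i with hfdef
  -- The exponent `0` serves as a dummy index for circuit forms without inner term and for the
  -- remainder `rest`.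
  set A : Finset (Fin n →₀ ℕ) :=
    insert 0 (f.support ∪ Finset.univ.biUnion fun i => (g i).support) with hA
  have h0A : (0 : Fin n →₀ ℕ) ∈ A := Finset.mem_insert_self _ _
  have hfA : f.support ⊆ A :=
    Finset.subset_union_left.trans (Finset.subset_insert _ _)
  have hgA : ∀ i, (g i).support ⊆ A := fun i =>
    (Finset.subset_biUnion_of_mem (fun i => (g i).support) (Finset.mem_univ i)).trans
      (Finset.subset_union_right.trans (Finset.subset_insert _ _))
  have hb : ∀ i, ∃ b ∈ A, nonSquares (g i) ⊆ {b} := by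
    intro i
    rcases (hg i).2.1.inner with ⟨b, hb, -⟩ | h
    · refine ⟨b, hgA i ?_, hb.subset⟩
      have : b ∈ nonSquares (g i) := by rw [hb]; exact Finset.mem_singleton_self b
      exact MvPolynomial.mem_support_iff.mpr (mem_nonSquares.mp this).1
    · exact ⟨0, h0A, by rw [h]; exact Finset.empty_subset _⟩
  choose b hbA hb using hb
  let P : ((Fin n →₀ ℕ) → ℝ) → Prop := fun c => ∀ t, 0 ≤ ∑ γ ∈ A, c γ * expMonomial γ t
  have hadd : ∀ c c', P c → P c' → P (c + c') := fun c c' h h' t => by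
    simp only [Pi.add_apply, add_mul, Finset.sum_add_distrib]
    exact add_nonneg (h t) (h' t)
  have hsmul : ∀ (r : ℝ) c, 0 ≤ r → P c → P (r • c) := fun r c hr h t => by
    simp only [Pi.smul_apply, smul_eq_mul, mul_assoc, ← Finset.mul_sum]
    exact mul_nonneg hr (h t)
  have hzero : P 0 := fun t => by simp
  let rest : (Fin n →₀ ℕ) → ℝ := sigCoeff f - ∑ i, sigCoeff (g i)
  have hrest : ∀ γ, 0 ≤ rest γ := fun γ => by
    simp only [rest, Pi.sub_apply, Finset.sum_apply, sub_nonneg]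
    exact sum_sigCoeff_le g γ
  let e : (Fin n →₀ ℕ) → (Fin n →₀ ℕ) → ℝ := fun k =>
    ∑ i with b i = k, sigCoeff (g i) + if k = 0 then rest else 0
  have heP : ∀ k ∈ A, P (e k) := by
    intro k _
    refine hadd _ _ (Finset.sum_induction _ P hadd hzero fun i _ t =>
      (hg i).2.2.sum_sigCoeff_nonneg (hb i) (hgA i) t) ?_
    split_ifs
    · exact fun t => Finset.sum_nonneg fun γ _ => mul_nonneg (hrest γ) (expMonomial_pos γ t).le
    · exact hzero
  have he0 : ∀ k ∈ A, ∀ j ∈ A, j ≠ k → 0 ≤ e k j := by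
    intro k _ j _ hjk
    simp only [e, Pi.add_apply, Finset.sum_apply]
    refine add_nonneg (Finset.sum_nonneg fun i hi => sigCoeff_nonneg fun hj => ?_) ?_
    · exact hjk ((Finset.mem_singleton.mp (hb i hj)).trans (Finset.mem_filter.mp hi).2)
    · split_ifs
      · exact hrest j
      · exact le_rfl
  have hesum : ∑ k ∈ A, e k = sigCoeff f := by
    simp only [e]
    rw [Finset.sum_add_distrib, Finset.sum_fiberwise_of_maps_to (fun i _ => hbA i),
      Finset.sum_ite_eq' A, if_pos h0A]
    simp only [rest]; abel
  obtain ⟨c, hcP, hc0, hcsum, hc⟩ := exists_cancellationFree A P hadd hsmul e heP he0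
  rw [hesum] at hcsum
  have hcsum' : ∀ j, ∑ k ∈ A, c k j = sigCoeff f j := fun j => by
    rw [← hcsum, Finset.sum_apply]
  have hSA : squares f ⊆ A := fun γ h => hfA (Finset.mem_filter.mp h).1
  have hIA : nonSquares f ⊆ A := fun γ h => hfA (Finset.mem_sdiff.mp h).1
  have hneg : ∀ β ∈ nonSquares f, ∀ k ∈ A, k ≠ β → c k β = 0 := by
    intro β hβ
    -- The column of `β` sums to `-|f_β| < 0`, so its diagonal entry cannot be nonnegative.
    refine (hc β (hIA hβ)).resolve_left fun h => ?_
    have h1 : 0 ≤ ∑ k ∈ A, c k β := Finset.sum_nonneg fun k hk => by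
      by_cases hkβ : k = β
      · rw [hkβ]; exact h
      · exact hc0 k hk β (hIA hβ) (Ne.symm hkβ)
    rw [hcsum', sigCoeff_of_notMem_squares (mem_nonSquares.mp hβ).2] at h1
    have := abs_pos.mpr (mem_nonSquares.mp hβ).1
    linarith
  have hdiag : ∀ β ∈ nonSquares f, c β β = - |f.coeff β| := by
    intro β hβ
    rw [← sigCoeff_of_notMem_squares (mem_nonSquares.mp hβ).2, ← hcsum' β,
      Finset.sum_eq_single_of_mem β (hIA hβ) fun k hk hkβ => hneg β hβ k hk hkβ]
  have hnonneg : ∀ j ∈ A, j ∉ nonSquares f → ∀ k ∈ A, 0 ≤ c k j := by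
    intro j hj hjI k hk
    by_cases hkj : k = j
    · subst hkj
      rcases hc k hk with h | h
      · exact h
      · rw [← Finset.sum_eq_single_of_mem k hk h, hcsum']
        exact sigCoeff_nonneg hjI
    · exact hc0 k hk j hj (Ne.symm hkj)
  have hSI : ∀ α ∈ squares f, α ∉ nonSquares f := fun α hα h => (mem_nonSquares.mp h).2 hα
  have houtside : ∀ j ∈ A, j ∉ nonSquares f → j ∉ squares f → ∀ k ∈ A, c k j = 0 := by
    intro j hj hjI hjS
    have hs : ∑ k ∈ A, c k j = 0 := by
      have : f.coeff j = 0 := by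
        by_contra h0; exact hjI (mem_nonSquares.mpr ⟨h0, hjS⟩)
      rw [hcsum', sigCoeff_of_notMem_squares hjS, this, abs_zero, neg_zero]
    exact (Finset.sum_eq_zero_iff_of_nonneg (hnonneg j hj hjI)).mp hs
  refine ⟨c, ?_, ?_, ?_⟩
  · exact fun β hβ α hα => hnonneg α (hSA hα) (hSI α hα) β (hIA hβ)
  · intro β hβ t
    have h := hcP β (hIA hβ) t
    rw [← Finset.add_sum_erase A _ (hIA hβ), hdiag β hβ] at h
    rw [Finset.sum_subset (s₂ := A.erase β) (fun α hα => Finset.mem_erase.mpr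
      ⟨fun h => hSI α hα (h ▸ hβ), hSA hα⟩)]
    · linarith
    · intro α hα hαS
      rw [Finset.mem_erase] at hα
      by_cases hαI : α ∈ nonSquares f
      · rw [hneg α hαI β (hIA hβ) (Ne.symm hα.1), zero_mul]
      · rw [houtside α hα.2 hαI hαS β (hIA hβ), zero_mul]
  · intro α hα
    rw [← sigCoeff_of_mem_squares hα, ← hcsum' α]
    exact Finset.sum_le_sum_of_subset_of_nonneg hIA fun k hk _ =>
      hnonneg α (hSA hα) (hSI α hα) k hk

/-! ### Simplices and faces around an inner exponent. -/

/-- Carathéodory reduction with cost `l`. It supplies both the existence of simplices in `D(β)` and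
the bounds on their barycentric coordinates, through the choice of `l`. -/
theorem exists_simplex_le {f : MvPolynomial (Fin n) ℝ} {β : Fin n →₀ ℕ}
    (l p : (Fin n →₀ ℕ) → ℝ) (hp : ∀ α ∈ squares f, 0 ≤ p α) (hp1 : ∑ α ∈ squares f, p α = 1)
    (hpβ : ∑ α ∈ squares f, p α • expVec α = expVec β) :
    ∃ V ∈ simplices f β, ∑ α ∈ V, baryCoord V β α * l α ≤ ∑ α ∈ squares f, p α * l α := by
  classical
  obtain ⟨V, hVS, w, hind, hpos, hw1, hwβ, hle⟩ :=
    exists_affineIndependent_combination expVec l (expVec β) (squares f) p hp hp1 hpβ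
  have hV : V ∈ simplices f β := by
    simp only [simplices, Finset.mem_filter, Finset.mem_powerset]
    exact ⟨hVS, hind, hwβ ▸ combination_mem_intrinsicInterior expVec V w hpos hw1⟩
  refine ⟨V, hV, ?_⟩
  have hw : IsBarycentric V β fun α => if α ∈ V then w α else 0 := by
    refine ⟨fun α hα => if_neg hα, ?_, ?_⟩
    · rw [← hw1]; exact Finset.sum_congr rfl fun α hα => if_pos hα
    · rw [← hwβ]; exact Finset.sum_congr rfl fun α hα => by simp only [if_pos hα]
  rw [(existsUnique_isBarycentric hV).unique (isBarycentric_baryCoord hV) hw]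
  refine le_of_eq_of_le (Finset.sum_congr rfl fun α hα => ?_) hle
  simp only [if_pos hα]

/-- The exponents in `squares f` that lie on the smallest face, containing `β`, of the cone
with apex `β` that they generate. -/
def faceSquares (f : MvPolynomial (Fin n) ℝ) (β : Fin n →₀ ℕ) : Finset (Fin n →₀ ℕ) :=
  open Classical in
  (squares f).filter fun α => ∀ u : Fin n → ℝ,
    (∀ α' ∈ squares f, (expVec α' - expVec β) ⬝ᵥ u ≤ 0) → 0 ≤ (expVec α - expVec β) ⬝ᵥ u

theorem faceSquares_subset (f : MvPolynomial (Fin n) ℝ) (β : Fin n →₀ ℕ) :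
    faceSquares f β ⊆ squares f := by
  classical
  exact Finset.filter_subset _ _

/-- By Farkas, `-(α - β)` lies in the cone generated by the vectors `α' - β`. Hence `β` is a convex
combination of squares with positive weight at `α`. -/
theorem exists_simplex_of_mem_faceSquares {f : MvPolynomial (Fin n) ℝ} {α β : Fin n →₀ ℕ}
    (hα : α ∈ faceSquares f β) : ∃ V ∈ simplices f β, α ∈ V := by
  classical
  obtain ⟨hαS, hface⟩ := Finset.mem_filter.mp hα
  obtain ⟨μ, hμ, hsum⟩ := farkas (squares f)
    (fun α => dotProductBilin ℝ ℝ (expVec α - expVec β))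
    (-dotProductBilin ℝ ℝ (expVec α - expVec β)) fun u hu => by
      simpa using hface u (by simpa using hu)
  have hvec : ∑ α ∈ squares f, μ α • (expVec α - expVec β) = -(expVec α - expVec β) := by
    ext i
    have := LinearMap.congr_fun hsum (Pi.single i 1)
    simpa using this.symm
  set M := 1 + ∑ α ∈ squares f, μ α with hM
  have hM0 : 0 < M := by linarith [Finset.sum_nonneg hμ]
  obtain ⟨V, hV, hle⟩ : ∃ V ∈ simplices f β,
      ∑ γ ∈ V, baryCoord V β γ * (if γ = α then -1 else 0) ≤
      ∑ γ ∈ squares f, M⁻¹ * (μ γ + if γ = α then 1 else 0) * (if γ = α then -1 else 0) := by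
    refine exists_simplex_le _ _ ?_ ?_ ?_
    · intro γ hγ
      have := hμ γ hγ
      split_ifs <;> positivity
    · rw [← Finset.mul_sum, Finset.sum_add_distrib, Finset.sum_ite_eq', if_pos hαS, add_comm]
      exact inv_mul_cancel₀ hM0.ne'
    · simp only [mul_smul, add_smul, ite_smul, one_smul, zero_smul]
      rw [← Finset.smul_sum, Finset.sum_add_distrib, Finset.sum_ite_eq', if_pos hαS]
      simp only [smul_sub, Finset.sum_sub_distrib, ← Finset.sum_smul] at hvec
      have : ∑ α ∈ squares f, μ α • expVec α + expVec α = M • expVec β := by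
        rw [sub_eq_iff_eq_add.mp hvec, hM, add_smul, one_smul]; abel
      rw [this, smul_smul, inv_mul_cancel₀ hM0.ne', one_smul]
  refine ⟨V, hV, ?_⟩
  by_contra hαV
  simp only [mul_ite, mul_neg, mul_one, mul_zero, Finset.sum_ite_eq', hαV, hαS, if_true,
    if_false] at hle
  have := hμ α hαS
  have : 0 < M⁻¹ * (μ α + 1) := by positivity
  linarith

theorem faceSquares_subset_sdiff {f : MvPolynomial (Fin n) ℝ} {β : Fin n →₀ ℕ}
    (hβ : β ∈ nonSquares f) : faceSquares f β ⊆ squares f \ unusedSquares f := by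
  intro α hα
  refine Finset.mem_sdiff.mpr ⟨faceSquares_subset f β hα, fun h => ?_⟩
  obtain ⟨V, hV, hαV⟩ := exists_simplex_of_mem_faceSquares hα
  simp only [unusedSquares, Finset.mem_filter] at h
  exact h.2 β hβ V hV hαV

/-- Each square off the face has a witness direction that is nonpositive on all squares and negative
there; the sum of these witnesses works for all at once. -/
theorem exists_exposing_direction (f : MvPolynomial (Fin n) ℝ) (β : Fin n →₀ ℕ) :
    ∃ u : Fin n → ℝ, (∀ α ∈ faceSquares f β, (expVec α - expVec β) ⬝ᵥ u = 0) ∧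
      ∀ α ∈ squares f, α ∉ faceSquares f β → (expVec α - expVec β) ⬝ᵥ u < 0 := by
  classical
  have h : ∀ α, ∃ u : Fin n → ℝ, (∀ α' ∈ squares f, (expVec α' - expVec β) ⬝ᵥ u ≤ 0) ∧
      (α ∈ squares f → α ∉ faceSquares f β → (expVec α - expVec β) ⬝ᵥ u < 0) := by
    intro α
    by_cases hα : α ∈ squares f ∧ α ∉ faceSquares f β
    · simp only [faceSquares, Finset.mem_filter, hα.1, true_and] at hα
      push Not at hα
      obtain ⟨u, hu, hlt⟩ := hα
      exact ⟨u, hu, fun _ _ => hlt⟩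
    · exact ⟨0, by simp, fun h h' => absurd ⟨h, h'⟩ hα⟩
  choose u hu hlt using h
  have hle : ∀ α ∈ squares f, (expVec α - expVec β) ⬝ᵥ ∑ γ ∈ squares f, u γ ≤ 0 := by
    intro α hα
    rw [dotProduct_sum]
    exact Finset.sum_nonpos fun γ _ => hu γ α hα
  refine ⟨∑ γ ∈ squares f, u γ, fun α hα => ?_, fun α hα hαF => ?_⟩
  · exact le_antisymm (hle α (faceSquares_subset f β hα)) ((Finset.mem_filter.mp hα).2 _ hle)
  · rw [dotProduct_sum]
    exact Finset.sum_neg' (fun γ _ => hu γ α hα) ⟨α, hα, hlt α hα hαF⟩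

/-- Terms away from the face of `β` may be dropped from a signomial inequality. -/
theorem le_sum_faceSquares {f : MvPolynomial (Fin n) ℝ} {β : Fin n →₀ ℕ}
    {c : (Fin n →₀ ℕ) → ℝ} {m : ℝ}
    (h : ∀ t, m * expMonomial β t ≤ ∑ α ∈ squares f, c α * expMonomial α t) (t : Fin n → ℝ) :
    m * expMonomial β t ≤ ∑ α ∈ faceSquares f β, c α * expMonomial α t := by
  classical
  -- Evaluate at `t + r • u`, divide by the factor of `β`, and let `r → ∞`: terms off the face
  -- decay, the others stay constant.
  obtain ⟨u, hu0, hu⟩ := exists_exposing_direction f β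
  have shift : ∀ (α : Fin n →₀ ℕ) (r : ℝ), expMonomial α (t + r • u) =
      expMonomial β (r • u) * (expMonomial α t * Real.exp ((expVec α - expVec β) ⬝ᵥ u * r)) := by
    intro α r
    simp only [expMonomial, ← Real.exp_add, dotProduct_add, dotProduct_smul, sub_dotProduct,
      smul_eq_mul]
    congr 1; ring
  have hr : ∀ r : ℝ, m * expMonomial β t ≤ ∑ α ∈ squares f,
      c α * (expMonomial α t * Real.exp ((expVec α - expVec β) ⬝ᵥ u * r)) := by
    intro r
    have := h (t + r • u)
    simp only [shift, sub_self, zero_dotProduct, zero_mul, Real.exp_zero, mul_one] at this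
    simp only [mul_left_comm _ (expMonomial β (r • u)), ← Finset.mul_sum] at this
    exact le_of_mul_le_mul_left this (expMonomial_pos _ _)
  have hlim : Filter.Tendsto (fun r : ℝ => ∑ α ∈ squares f,
      c α * (expMonomial α t * Real.exp ((expVec α - expVec β) ⬝ᵥ u * r))) Filter.atTop
      (nhds (∑ α ∈ squares f, if α ∈ faceSquares f β then c α * expMonomial α t else 0)) := by
    refine tendsto_finsetSum _ fun α hα => ?_
    split_ifs with hF
    · simp only [hu0 α hF, zero_mul, Real.exp_zero, mul_one]
      exact tendsto_const_nhds
    · have h0 : Filter.Tendsto (fun r : ℝ => Real.exp ((expVec α - expVec β) ⬝ᵥ u * r))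
          Filter.atTop (nhds 0) :=
        Real.tendsto_exp_atBot.comp (Filter.tendsto_id.const_mul_atTop_of_neg (hu α hα hF))
      simpa using (h0.const_mul (expMonomial α t)).const_mul (c α)
  have := ge_of_tendsto' hlim hr
  rwa [← Finset.sum_filter, Finset.filter_mem_eq_inter,
    Finset.inter_eq_right.mpr (faceSquares_subset f β)] at this

/-- A signomial inequality that is tight at the origin forces a barycentric relation between the
exponents. -/
theorem sum_smul_expVec_of_tight {T : Finset (Fin n →₀ ℕ)} {β : Fin n →₀ ℕ}
    {c : (Fin n →₀ ℕ) → ℝ} {m : ℝ}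
    (h : ∀ t, m * expMonomial β t ≤ ∑ α ∈ T, c α * expMonomial α t) (h0 : ∑ α ∈ T, c α = m) :
    ∑ α ∈ T, c α • expVec α = m • expVec β := by
  classical
  ext i
  let F : ℝ → ℝ := fun r => ∑ α ∈ T, c α * Real.exp (expVec α i * r) -
    m * Real.exp (expVec β i * r)
  have hexp : ∀ (α : Fin n →₀ ℕ) (r : ℝ),
      expMonomial α (Pi.single i r) = Real.exp (expVec α i * r) := fun α r => by
    simp [expMonomial]
  have hF : IsLocalMin F 0 := by
    refine Filter.Eventually.of_forall fun r => ?_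
    have := h (Pi.single i r)
    simp only [hexp] at this
    simp only [F, mul_zero, Real.exp_zero, mul_one, h0, sub_self, sub_nonneg]
    exact this
  have hterm : ∀ a : ℝ, HasDerivAt (fun r => Real.exp (a * r)) a 0 := fun a => by
    simpa using ((hasDerivAt_id (0 : ℝ)).const_mul a).exp
  have hderiv : HasDerivAt F (∑ α ∈ T, c α * expVec α i - m * expVec β i) 0 :=
    (HasDerivAt.fun_sum fun α _ => (hterm (expVec α i)).const_mul (c α)).sub
      ((hterm (expVec β i)).const_mul m)
  have := hF.hasDerivAt_eq_zero hderiv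
  simpa [Finset.sum_apply] using sub_eq_zero.mp this

end SONC
end

/-! ### The corollary. -/

theorem mainTheorem9 (n d : ℕ) (f : MvPolynomial (Fin n) ℝ) (hf : SONC.IsSONC d f)
    (heq : ∑ β ∈ SONC.nonSquares f, |f.coeff β| =
      ∑ α ∈ SONC.squares f \ SONC.unusedSquares f, f.coeff α) :
    ∀ α ∈ SONC.squares f \ SONC.unusedSquares f, ∀ β ∈ SONC.nonSquares f,
      ∃ h : (SONC.simplices f β).Nonempty,
        (SONC.simplices f β).inf' h (fun V => SONC.baryCoord V β α * |f.coeff β|)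
          ≤ f.coeff α := by
  classical
  intro α hα β hβ
  obtain ⟨c, hc0, hc, hcle⟩ := hf.exists_decomposition
  have hface := fun β hβ => SONC.le_sum_faceSquares (hc β hβ)
  have hle : ∀ β ∈ SONC.nonSquares f, |f.coeff β| ≤ ∑ α ∈ SONC.faceSquares f β, c β α := by
    intro β hβ
    simpa [SONC.expMonomial_zero] using hface β hβ 0
  have hsub : ∀ β ∈ SONC.nonSquares f, ∑ α ∈ SONC.faceSquares f β, c β α ≤
      ∑ α ∈ SONC.squares f \ SONC.unusedSquares f, c β α := fun β hβ =>
    Finset.sum_le_sum_of_subset_of_nonneg (SONC.faceSquares_subset_sdiff hβ) fun α hα _ =>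
      hc0 β hβ α (Finset.mem_sdiff.mp hα).1
  have htotal : ∑ β ∈ SONC.nonSquares f, ∑ α ∈ SONC.faceSquares f β, c β α ≤
      ∑ β ∈ SONC.nonSquares f, |f.coeff β| := by
    rw [heq]
    refine (Finset.sum_le_sum hsub).trans ?_
    rw [Finset.sum_comm]
    exact Finset.sum_le_sum fun α hα => hcle α (Finset.mem_sdiff.mp hα).1
  have htight := ((Finset.sum_eq_sum_iff_of_le hle).mp
    (le_antisymm (Finset.sum_le_sum hle) htotal) β hβ).symm
  have hbary := SONC.sum_smul_expVec_of_tight (hface β hβ) htight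
  have hm : 0 < |f.coeff β| := abs_pos.mpr (SONC.mem_nonSquares.mp hβ).1
  have hS := SONC.faceSquares_subset f β
  have hαS := (Finset.mem_sdiff.mp hα).1
  -- The cost is the indicator of `α`, so the simplex obtained has a barycentric coordinate at `α`
  -- no larger than the given weight, which is zero off the face.
  obtain ⟨V, hV, hVle⟩ : ∃ V ∈ SONC.simplices f β,
      ∑ γ ∈ V, SONC.baryCoord V β γ * (Pi.single α 1 : (Fin n →₀ ℕ) → ℝ) γ ≤
      ∑ γ ∈ SONC.squares f, (if γ ∈ SONC.faceSquares f β then |f.coeff β|⁻¹ * c β γ else 0) *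
        (Pi.single α 1 : (Fin n →₀ ℕ) → ℝ) γ := by
    refine SONC.exists_simplex_le _ _ ?_ ?_ ?_
    · intro γ hγ
      have := hc0 β hβ γ hγ
      split_ifs <;> positivity
    · rw [← Finset.sum_filter, Finset.filter_mem_eq_inter, Finset.inter_eq_right.mpr hS,
        ← Finset.mul_sum, htight, inv_mul_cancel₀ hm.ne']
    · simp only [ite_smul, zero_smul]
      rw [← Finset.sum_filter, Finset.filter_mem_eq_inter, Finset.inter_eq_right.mpr hS]
      simp only [mul_smul]
      rw [← Finset.smul_sum, hbary, smul_smul, inv_mul_cancel₀ hm.ne', one_smul]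
  refine ⟨⟨V, hV⟩, (Finset.inf'_le _ hV).trans ?_⟩
  have hcα : c β α ≤ f.coeff α :=
    (Finset.single_le_sum (f := fun β => c β α) (fun β hβ => hc0 β hβ α hαS) hβ).trans
      (hcle α hαS)
  have hlam : SONC.baryCoord V β α ≤ |f.coeff β|⁻¹ * c β α := by
    have hl : ∑ γ ∈ V, SONC.baryCoord V β γ * (Pi.single α 1 : (Fin n →₀ ℕ) → ℝ) γ =
        SONC.baryCoord V β α := by
      by_cases hαV : α ∈ V
      · rw [Finset.sum_eq_single_of_mem α hαV fun γ _ h => by simp [h]]; simp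
      · rw [(SONC.isBarycentric_baryCoord hV).1 α hαV]
        refine Finset.sum_eq_zero fun γ hγ => ?_
        rw [Pi.single_eq_of_ne (ne_of_mem_of_not_mem hγ hαV), mul_zero]
    rw [hl, Finset.sum_eq_single_of_mem α hαS fun γ _ h => by simp [h], Pi.single_eq_same,
      mul_one] at hVle
    refine hVle.trans ?_
    split_ifs
    · exact le_rfl
    · exact mul_nonneg (inv_nonneg.mpr hm.le) (hc0 β hβ α hαS)
  refine (mul_le_mul_of_nonneg_right hlam hm.le).trans (le_of_eq_of_le ?_ hcα)
  field_simp
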